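/- **Theorem (Strong converse exponent for sets of quantum states).** Let $\mathcal H$ be a finite-dimensional Hilbert space and $r>0$. All logarithms are to base two, with $\log 0=-\infty$, and all inequalities, limits and suprema below are in $[-\infty,+\infty]$. For $n\ge 1$ let $\mathcal A_n,\mathcal B_n$ be nonempty, convex, compact sets of density operators on $\mathcal H^{\otimes n}$, and suppose that both sequences are stable under tensor products: $\mathcal A_m\otimes\mathcal A_n\subseteq\mathcal A_{m+n}$ and $\mathcal B_m\otimes\mathcal B_n\subseteq\mathcal B_{m+n}$ for all $m,n\ge1$. Let $$\alpha_{n,r}(\mathcal A_n\|\mathcal B_n)=\min_{0\le M\le I}\Big\{\sup_{\rho\in\mathcal A_n}\operatorname{tr}[\rho(I-M)]\ :\ \sup_{\sigma\in\mathcal B_n}\operatorname{tr}[\sigma M]\le 2^{-nr}\Big\}$$ be the optimal worst-case type-I error. For $\alpha>1$ let $$D_\alpha(\rho\|\sigma)=\frac1{\alpha-1}\log\operatorname{tr}\Big[\big(\sigma^{\frac{1-\alpha}{2\alpha}}\rho\,\sigma^{\frac{1-\alpha}{2\alpha}}\big)^\alpha\Big]$$ if $\operatorname{supp}\rho\subseteq\operatorname{supp}\sigma$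 (powers of $\sigma$ being taken on its support), and $D_\alpha(\rho\|\sigma)=+\infty$ otherwise, be the sandwiched Rényi divergence, and let $$H^*_{n,r}(\mathcal A_n\|\mathcal B_n)=\sup_{\rho\in\mathcal A_n,\ \sigma\in\mathcal B_n}\ \sup_{\alpha>1}\ \frac{\alpha-1}{\alpha}\big(nr-D_\alpha(\rho\|\sigma)\big).$$ Then $$\liminf_{n\to\infty}-\frac1n\log\big(1-\alpha_{n,r}(\mathcal A_n\|\mathcal B_n)\big)\ \ge\ \liminf_{n\to\infty}\frac1n H^*_{n,r}(\mathcal A_n\|\mathcal B_n).$$ Moreover, if for all sufficiently large $n$ there are $\rho\in\mathcal A_n$ and $\sigma\in\mathcal B_n$ with $\operatorname{supp}\rho\subseteq\operatorname{supp}\sigma$, then the regularized Hoeffding anti-divergence $H_r^{*,\infty}(\mathcal A\|\mathcal B)=\lim_{n\to\infty}\frac1n H^*_{n,r}(\mathcal A_n\|\mathcal B_n)$ exists, and $$\liminf_{n\to\infty}-\frac1n\log\big(1-\alpha_{n,r}(\mathcal A_n\|\mathcal B_n)\big)\ \ge\ H_r^{*,\infty}(\mathcal A\|\mathcal B).$$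 -/

import Mathlib

open Filter Topology
open scoped ComplexOrder Kronecker

noncomputable section

namespace QHT

/-- Operators on the `n`-fold tensor power of the Hilbert space with orthonormal basis `ι`.
The product basis of the tensor power is indexed by the words `Fin n → ι`. -/
abbrev Op (ι : Type*) (n : ℕ) : Type _ := Matrix (Fin n → ι) (Fin n → ι) ℂ

/-- The tensor product of operators on the `m`-th and on the `n`-th tensor power, as an operator
on the `(m + n)`-th tensor power (words are concatenated). -/
def tensor {ι : Type*} {m n : ℕ} (X : Op ι m) (Y : Op ι n) : Op ι (m + n) :=
  Matrix.reindex (Fin.appendEquiv m n) (Fin.appendEquiv m n) (X ⊗ₖ Y)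

section Single

variable {κ : Type*} [Fintype κ] [DecidableEq κ]

/-- Density operators: positive semidefinite with unit trace. -/
def density (κ : Type*) [Fintype κ] : Set (Matrix κ κ ℂ) :=
  {ρ | ρ.PosSemidef ∧ ρ.trace = 1}

/-- `supp ρ ⊆ supp σ`; the support of a Hermitian operator is its range. -/
def SuppLE (ρ σ : Matrix κ κ ℂ) : Prop :=
  LinearMap.range ρ.mulVecLin ≤ LinearMap.range σ.mulVecLin

/-- The real power `X ^ p` of a positive semidefinite operator, through its spectral decomposition.
For `p ≠ 0` the kernel of `X` is sent to `0` (also when `p < 0`), as `(0 : ℝ) ^ p = 0`. -/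
def opPow (X : Matrix κ κ ℂ) (p : ℝ) : Matrix κ κ ℂ :=
  cfc (fun x : ℝ => x ^ p) X

open Classical in
/-- The sandwiched Rényi divergence of order `α` (logarithm to base two). -/
def sandwichedDiv (α : ℝ) (ρ σ : Matrix κ κ ℂ) : EReal :=
  if SuppLE ρ σ then
    ((1 / (α - 1) * Real.logb 2 (opPow
      (opPow σ ((1 - α) / (2 * α)) * ρ * opPow σ ((1 - α) / (2 * α))) α).trace.re : ℝ) : EReal)
  else ⊤

/-- The Hoeffding anti-divergence `sup_{α > 1} (α - 1) / α * (s - D_α(ρ‖σ))` of two states;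
on the `n`-th tensor power it is used with `s = n * r`. -/
def antiDiv (s : ℝ) (ρ σ : Matrix κ κ ℂ) : EReal :=
  ⨆ (α : ℝ) (_ : 1 < α), (((α - 1) / α : ℝ) : EReal) * ((s : EReal) - sandwichedDiv α ρ σ)

/-- The Hoeffding anti-divergence of two sets of states, the supremum over all pairs. -/
def antiDivSet (s : ℝ) (A B : Set (Matrix κ κ ℂ)) : EReal :=
  ⨆ (ρ ∈ A) (σ ∈ B), antiDiv s ρ σ

/-- Test operators `0 ≤ M ≤ I`. -/
def IsTest (M : Matrix κ κ ℂ) : Prop := M.PosSemidef ∧ (1 - M).PosSemidef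

/-- Worst-case type-I error `sup_{ρ ∈ A} tr[ρ (I - M)]`. -/
def typeI (A : Set (Matrix κ κ ℂ)) (M : Matrix κ κ ℂ) : ℝ :=
  sSup ((fun ρ => (ρ * (1 - M)).trace.re) '' A)

/-- Worst-case type-II error `sup_{σ ∈ B} tr[σ M]`. -/
def typeII (B : Set (Matrix κ κ ℂ)) (M : Matrix κ κ ℂ) : ℝ :=
  sSup ((fun σ => (σ * M).trace.re) '' B)

/-- Optimal worst-case type-I error when the worst-case type-II error is at most `ε`. -/
def optTypeI (ε : ℝ) (A B : Set (Matrix κ κ ℂ)) : ℝ :=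
  sInf (typeI A '' {M | IsTest M ∧ typeII B M ≤ ε})

end Single

/-- The base-two logarithm of a nonnegative real number, with `log 0 = -∞`. -/
def elog2 (x : ℝ) : EReal := if x ≤ 0 then ⊥ else (Real.logb 2 x : EReal)

section Sequences

variable {ι : Type*} [Fintype ι] [DecidableEq ι]

/-- Stability under tensor products: `C_m ⊗ C_n ⊆ C_{m+n}` for all `m, n ≥ 1`. -/
def IsStable (C : (n : ℕ) → Set (Op ι n)) : Prop :=
  ∀ m n : ℕ, 1 ≤ m → 1 ≤ n → ∀ X ∈ C m, ∀ Y ∈ C n, tensor X Y ∈ C (m + n)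

/-- `(1 / n) H*_{n,r}(A_n‖B_n)`. -/
def antiDivRate (r : ℝ) (A B : (n : ℕ) → Set (Op ι n)) (n : ℕ) : EReal :=
  ((1 / (n : ℝ) : ℝ) : EReal) * antiDivSet ((n : ℝ) * r) (A n) (B n)

/-- The lower regularized Hoeffding anti-divergence `liminf_n (1 / n) H*_{n,r}(A_n‖B_n)`. -/
def lowerRegAntiDiv (r : ℝ) (A B : (n : ℕ) → Set (Op ι n)) : EReal :=
  liminf (antiDivRate r A B) atTop

/-- `L` is the regularized Hoeffding anti-divergence: `(1 / n) H*_{n,r}(A_n‖B_n)` converges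
to `L` in the extended reals. -/
def IsRegAntiDiv (r : ℝ) (A B : (n : ℕ) → Set (Op ι n)) (L : EReal) : Prop :=
  Tendsto (antiDivRate r A B) atTop (𝓝 L)

/-- The optimal type-I error `α_{n,r}(A_n‖B_n)`, with type-II error at most `2 ^ (-n r)`. -/
def alphaErr (r : ℝ) (A B : (n : ℕ) → Set (Op ι n)) (n : ℕ) : ℝ :=
  optTypeI ((2 : ℝ) ^ (-((n : ℝ) * r))) (A n) (B n)

/-- The strong converse exponent `liminf_n -(1 / n) log (1 - α_{n,r}(A_n‖B_n))`. -/
def strongConverseExponent (r : ℝ) (A B : (n : ℕ) → Set (Op ι n)) : EReal :=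
  liminf (fun n : ℕ => -(((1 / (n : ℝ) : ℝ) : EReal) * elog2 (1 - alphaErr r A B n))) atTop

end Sequences

end QHT

end

/-!
The first inequality holds already at every fixed `n`, with no minimax argument
(`antiDivSet_le_neg_elog2`). Fix states `ρ`, `σ` with `supp ρ ⊆ supp σ`, a test `M` and an order
`α > 1`, let `β = α / (α - 1)` and let `Q` be the trace defining `D_α(ρ‖σ)`. The support condition
gives `tr[ρ M] = tr[(σ^(-1/2β) ρ σ^(-1/2β)) (σ^(1/2β) M σ^(1/2β))]`, which by Hölder's inequality is
at most `Q^(1/α) (tr[(σ^(1/2β) M σ^(1/2β))^β])^(1/β)`. The last trace is at most `tr[σ M]`: with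
`K = M^(1/2)` the operator inside has the eigenvalues of `K σ^(1/β) K`, and for a unit eigenvector
`v` of the latter the vector `K v` has norm at most one, so that Jensen's inequality for `t ↦ t^β`
applies (`re_trace_opPow_conj_test_le`). Altogether `tr[ρ M] ≤ Q^(1/α) tr[σ M]^((α-1)/α)`
(`re_trace_mul_test_le`), and taking logarithms bounds `-log tr[ρ M]` from below by
`(α-1)/α (n r - D_α(ρ‖σ))` whenever `tr[σ M] ≤ 2^(-n r)`. Pairs without the support condition
contribute `-∞`.

For the existence of the limit, the anti-divergence itself is not superadditive on products of
pairs, because the best `α` depends on the pair. At a fixed `α`, however, `D_α` is additive under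
tensor products (`sandwichedQ_tensor`). Hence a pair `(ρ, σ)` at blocklength `m` can be
repeated, with one more pair of bounded blocklength and finite divergence filling the remainder, and
its normalized value at order `α` is recovered in the limit along all blocklengths.
Thus the sequence converges to its supremum over `n ≥ 1` (`isRegAntiDiv_supAntiDivRate`).
-/

namespace QHT
open Matrix

section Single

variable {κ : Type*} [Fintype κ] [DecidableEq κ]

/-! ### Real powers in an arbitrary diagonalization -/

theorem aeval_unitary_conj_diagonal {U : Matrix κ κ ℂ} (hU : Uᴴ * U = 1) (d : κ → ℝ)
    (P : Polynomial ℝ) :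
    Polynomial.aeval (U * diagonal (fun i => (d i : ℂ)) * Uᴴ) P =
      U * diagonal (fun i => ((P.eval (d i) : ℝ) : ℂ)) * Uᴴ := by
  have hU' : U * Uᴴ = 1 := mul_eq_one_comm.mp hU
  induction P using Polynomial.induction_on' with
  | add p q hp hq =>
    rw [map_add, hp, hq, ← add_mul, ← mul_add, diagonal_add]
    simp
  | monomial n a =>
    have hpow : ∀ n : ℕ, (U * diagonal (fun i => (d i : ℂ)) * Uᴴ) ^ n =
        U * diagonal (fun i => (d i : ℂ) ^ n) * Uᴴ := by
      intro n
      induction n with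
      | zero => simp [hU']
      | succ n ih =>
        rw [pow_succ, ih]
        calc _ = U * diagonal (fun i => (d i : ℂ) ^ n) * (Uᴴ * U) *
              diagonal (fun i => (d i : ℂ)) * Uᴴ := by simp only [mul_assoc]
          _ = _ := by
            rw [hU, mul_one, mul_assoc U, diagonal_mul_diagonal]
            simp only [pow_succ]
    rw [Polynomial.aeval_monomial, hpow, ← Algebra.smul_def, ← smul_mul_assoc, ← mul_smul_comm,
      ← diagonal_smul]
    congr 3
    ext i
    simp

/-- The functional calculus can be evaluated in any diagonalization, not only in the one chosen by
the spectral theorem. The spectrum is finite, so every function agrees with a polynomial there. -/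
theorem cfc_unitary_conj_diagonal {U : Matrix κ κ ℂ} (hU : Uᴴ * U = 1) (d : κ → ℝ) (f : ℝ → ℝ) :
    cfc f (U * diagonal (fun i => (d i : ℂ)) * Uᴴ) =
      U * diagonal (fun i => (f (d i) : ℂ)) * Uᴴ := by
  set A := U * diagonal (fun i => (d i : ℂ)) * Uᴴ with hA
  have hsa : IsSelfAdjoint A := by
    change Aᴴ = A
    rw [hA, conjTranspose_mul, conjTranspose_mul, conjTranspose_conjTranspose,
      diagonal_conjTranspose, mul_assoc]
    congr 3
    ext i
    simp
  let S : Finset ℝ := (finite_real_spectrum (A := A)).toFinset ∪ Finset.univ.image d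
  let P := Lagrange.interpolate S id f
  have hP : ∀ x ∈ S, P.eval x = f x := fun x hx =>
    Lagrange.eval_interpolate_at_node (v := id) f Function.injective_id.injOn hx
  have h1 : cfc f A = cfc P.eval A := cfc_congr fun x hx =>
    (hP x (Finset.mem_union_left _ ((Set.Finite.mem_toFinset _).2 hx))).symm
  rw [h1, cfc_polynomial P A hsa, hA, aeval_unitary_conj_diagonal hU]
  congr 3
  ext i
  rw [hP _ (Finset.mem_union_right _ (Finset.mem_image_of_mem d (Finset.mem_univ i)))]

theorem opPow_unitary_conj_diagonal {U : Matrix κ κ ℂ} (hU : Uᴴ * U = 1) (d : κ → ℝ) (p : ℝ) :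
    opPow (U * diagonal (fun i => (d i : ℂ)) * Uᴴ) p =
      U * diagonal (fun i => ((d i ^ p : ℝ) : ℂ)) * Uᴴ :=
  cfc_unitary_conj_diagonal hU d _

theorem exists_unitary_conj_diagonal {X : Matrix κ κ ℂ} (hX : X.PosSemidef) :
    ∃ (U : Matrix κ κ ℂ) (d : κ → ℝ), Uᴴ * U = 1 ∧ (∀ i, 0 ≤ d i) ∧
      X = U * diagonal (fun i => (d i : ℂ)) * Uᴴ :=
  ⟨hX.1.eigenvectorUnitary, hX.1.eigenvalues,
    Unitary.coe_star_mul_self hX.1.eigenvectorUnitary, hX.eigenvalues_nonneg,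
    hX.1.spectral_theorem⟩

theorem posSemidef_unitary_conj_diagonal (U : Matrix κ κ ℂ) {d : κ → ℝ} (hd : ∀ i, 0 ≤ d i) :
    (U * diagonal (fun i => (d i : ℂ)) * Uᴴ).PosSemidef :=
  (PosSemidef.diagonal fun i => Complex.zero_le_real.2 (hd i)).mul_mul_conjTranspose_same U

theorem opPow_posSemidef {X : Matrix κ κ ℂ} (hX : X.PosSemidef) (p : ℝ) :
    (opPow X p).PosSemidef := by
  obtain ⟨U, d, hU, hd, rfl⟩ := exists_unitary_conj_diagonal hX
  rw [opPow_unitary_conj_diagonal hU]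
  exact posSemidef_unitary_conj_diagonal U fun i => Real.rpow_nonneg (hd i) p

theorem opPow_opPow {X : Matrix κ κ ℂ} (hX : X.PosSemidef) (p q : ℝ) :
    opPow (opPow X p) q = opPow X (p * q) := by
  obtain ⟨U, d, hU, hd, rfl⟩ := exists_unitary_conj_diagonal hX
  rw [opPow_unitary_conj_diagonal hU, opPow_unitary_conj_diagonal hU,
    opPow_unitary_conj_diagonal hU]
  simp only [Real.rpow_mul (hd _)]

theorem opPow_one {X : Matrix κ κ ℂ} (hX : X.PosSemidef) : opPow X 1 = X := by
  obtain ⟨U, d, hU, hd, rfl⟩ := exists_unitary_conj_diagonal hX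
  rw [opPow_unitary_conj_diagonal hU]
  simp only [Real.rpow_one]

theorem conj_diagonal_mul_conj_diagonal {U : Matrix κ κ ℂ} (hU : Uᴴ * U = 1) (a b : κ → ℝ) :
    U * diagonal (fun i => (a i : ℂ)) * Uᴴ * (U * diagonal (fun i => (b i : ℂ)) * Uᴴ) =
      U * diagonal (fun i => ((a i * b i : ℝ) : ℂ)) * Uᴴ := by
  calc _ = U * diagonal (fun i => (a i : ℂ)) * (Uᴴ * U) * diagonal (fun i => (b i : ℂ)) * Uᴴ := by
        simp only [mul_assoc]
    _ = _ := by
      rw [hU, mul_one, mul_assoc U, diagonal_mul_diagonal]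
      simp only [Complex.ofReal_mul]

theorem opPow_mul_opPow {X : Matrix κ κ ℂ} (hX : X.PosSemidef) {p q : ℝ} (h : p + q ≠ 0) :
    opPow X p * opPow X q = opPow X (p + q) := by
  obtain ⟨U, d, hU, hd, rfl⟩ := exists_unitary_conj_diagonal hX
  rw [opPow_unitary_conj_diagonal hU, opPow_unitary_conj_diagonal hU,
    opPow_unitary_conj_diagonal hU, conj_diagonal_mul_conj_diagonal hU]
  simp only [Real.rpow_add' (hd _) h]

/-- `X ^ p * X ^ (-p)` is the projection onto the support of `X`. -/
theorem opPow_mul_opPow_neg_mul_self {X : Matrix κ κ ℂ} (hX : X.PosSemidef) (p : ℝ) :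
    opPow X p * opPow X (-p) * X = X := by
  obtain ⟨U, d, hU, hd, rfl⟩ := exists_unitary_conj_diagonal hX
  rw [opPow_unitary_conj_diagonal hU, opPow_unitary_conj_diagonal hU,
    conj_diagonal_mul_conj_diagonal hU, conj_diagonal_mul_conj_diagonal hU]
  congr 3
  ext i
  rcases (hd i).eq_or_lt with h | h
  · simp [← h]
  · rw [← Real.rpow_add h, add_neg_cancel, Real.rpow_zero, one_mul]

/-! ### Supports -/

theorem suppLE_iff_exists_eq_mul {ρ σ : Matrix κ κ ℂ} : SuppLE ρ σ ↔ ∃ Z, ρ = σ * Z := by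
  constructor
  · intro h
    have h' : ∀ i, ∃ v, σ *ᵥ v = ρ *ᵥ Pi.single i 1 := fun i =>
      h ⟨Pi.single i 1, rfl⟩
    choose v hv using h'
    refine ⟨of fun j i => v i j, ?_⟩
    ext j i
    have := congrFun (hv i) j
    rw [mulVec_single_one] at this
    exact this.symm
  · rintro ⟨Z, rfl⟩ _ ⟨v, rfl⟩
    exact ⟨Z *ᵥ v, by simp⟩

/-- A state supported in `supp σ` is unchanged by compression to the support of `σ`. -/
theorem SuppLE.eq_conj {ρ σ : Matrix κ κ ℂ} (h : SuppLE ρ σ) (hρ : ρ.PosSemidef)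
    (hσ : σ.PosSemidef) (p : ℝ) :
    opPow σ p * (opPow σ (-p) * ρ * opPow σ (-p)) * opPow σ p = ρ := by
  obtain ⟨Z, hZ⟩ := suppLE_iff_exists_eq_mul.1 h
  have h1 : opPow σ p * opPow σ (-p) * ρ = ρ := by
    rw [hZ, ← mul_assoc, opPow_mul_opPow_neg_mul_self hσ]
  have h2 : ρ * (opPow σ (-p) * opPow σ p) = ρ := by
    have := congrArg conjTranspose h1
    rwa [conjTranspose_mul, conjTranspose_mul, hρ.1.eq, (opPow_posSemidef hσ p).1.eq,
      (opPow_posSemidef hσ (-p)).1.eq] at this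
  calc _ = opPow σ p * opPow σ (-p) * ρ * (opPow σ (-p) * opPow σ p) := by simp only [mul_assoc]
    _ = ρ := by rw [h1, h2]

/-! ### Jensen, Hölder and Araki–Lieb–Thirring inequalities -/

theorem dotProduct_conj_diagonal_mulVec (U : Matrix κ κ ℂ) (d : κ → ℝ) (v : κ → ℂ) :
    (star v ⬝ᵥ (U * diagonal (fun i => (d i : ℂ)) * Uᴴ) *ᵥ v).re =
      ∑ i, Complex.normSq ((Uᴴ *ᵥ v) i) * d i := by
  have h : star v ᵥ* U = star (Uᴴ *ᵥ v) := by rw [star_mulVec, conjTranspose_conjTranspose]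
  rw [← mulVec_mulVec, ← mulVec_mulVec, dotProduct_mulVec, h, dotProduct, Complex.re_sum]
  refine Finset.sum_congr rfl fun i _ => ?_
  rw [mulVec_diagonal, Complex.normSq_apply]
  simp
  ring

/-- Jensen's inequality in a subnormalized vector state. -/
theorem dotProduct_mulVec_rpow_le {Y : Matrix κ κ ℂ} (hY : Y.PosSemidef) {β : ℝ} (hβ : 1 ≤ β)
    {v : κ → ℂ} (hv : (star v ⬝ᵥ v).re ≤ 1) :
    (star v ⬝ᵥ Y *ᵥ v).re ^ β ≤ (star v ⬝ᵥ opPow Y β *ᵥ v).re := by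
  obtain ⟨U, d, hU, hd, rfl⟩ := exists_unitary_conj_diagonal hY
  have hβ0 : 0 < β := by linarith
  have hw : ∑ i, Complex.normSq ((Uᴴ *ᵥ v) i) ≤ 1 := by
    have := dotProduct_conj_diagonal_mulVec U (fun _ => 1) v
    simp only [Complex.ofReal_one, diagonal_one, mul_one, mul_eq_one_comm.mp hU, one_mulVec] at this
    rwa [← this]
  rw [opPow_unitary_conj_diagonal hU, dotProduct_conj_diagonal_mulVec,
    dotProduct_conj_diagonal_mulVec]
  have hS : 0 ≤ ∑ i, Complex.normSq ((Uᴴ *ᵥ v) i) * d i ^ β :=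
    Finset.sum_nonneg fun i _ => mul_nonneg (Complex.normSq_nonneg _) (Real.rpow_nonneg (hd i) _)
  have hW0 : 0 ≤ ∑ i, Complex.normSq ((Uᴴ *ᵥ v) i) :=
    Finset.sum_nonneg fun i _ => Complex.normSq_nonneg _
  have h1 := Real.inner_le_weight_mul_Lp_of_nonneg Finset.univ hβ
    (fun i => Complex.normSq ((Uᴴ *ᵥ v) i)) d (fun i => Complex.normSq_nonneg _) hd
  have h2 : (∑ i, Complex.normSq ((Uᴴ *ᵥ v) i)) ^ (1 - β⁻¹) ≤ 1 :=
    Real.rpow_le_one hW0 hw (by linarith [inv_le_one_of_one_le₀ hβ])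
  have h3 := h1.trans (mul_le_of_le_one_left (Real.rpow_nonneg hS _) h2)
  calc _ ≤ _ := Real.rpow_le_rpow
        (Finset.sum_nonneg fun i _ => mul_nonneg (Complex.normSq_nonneg _) (hd i)) h3 hβ0.le
    _ = _ := Real.rpow_inv_rpow hS hβ0.ne'

theorem conj_apply_diag {l : Type*} [Fintype l] (U Y : Matrix l l ℂ) (i : l) :
    (Uᴴ * Y * U) i i = star (Uᵀ i) ⬝ᵥ Y *ᵥ (Uᵀ i) := by
  rw [mul_assoc]
  rfl

theorem re_trace_opPow {U : Matrix κ κ ℂ} (hU : Uᴴ * U = 1) (d : κ → ℝ) (p : ℝ) :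
    (opPow (U * diagonal (fun i => (d i : ℂ)) * Uᴴ) p).trace.re = ∑ i, d i ^ p := by
  rw [opPow_unitary_conj_diagonal hU, trace_mul_comm, ← mul_assoc, hU, one_mul, trace_diagonal,
    Complex.re_sum]
  simp only [Complex.ofReal_re]

theorem re_trace_opPow_nonneg {X : Matrix κ κ ℂ} (hX : X.PosSemidef) (p : ℝ) :
    0 ≤ (opPow X p).trace.re :=
  (Complex.le_def.1 (opPow_posSemidef hX p).trace_nonneg).1

/-- Hölder's inequality for the Schatten norms of two positive semidefinite matrices. -/
theorem re_trace_mul_le_holder {X Y : Matrix κ κ ℂ} (hX : X.PosSemidef) (hY : Y.PosSemidef)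
    {α β : ℝ} (h : α.HolderConjugate β) :
    (X * Y).trace.re ≤ (opPow X α).trace.re ^ (1 / α) * (opPow Y β).trace.re ^ (1 / β) := by
  obtain ⟨U, a, hU, ha, rfl⟩ := exists_unitary_conj_diagonal hX
  set c : κ → ℝ := fun i => (star (Uᵀ i) ⬝ᵥ Y *ᵥ (Uᵀ i)).re with hc
  have hc0 : ∀ i, 0 ≤ c i := fun i => hY.re_dotProduct_nonneg _
  have hcol : ∀ i, (star (Uᵀ i) ⬝ᵥ Uᵀ i).re ≤ 1 := fun i => by
    have := conj_apply_diag U 1 i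
    rw [one_mulVec, mul_one, hU, one_apply_eq] at this
    rw [← this, Complex.one_re]
  have htr : (U * diagonal (fun i => (a i : ℂ)) * Uᴴ * Y).trace.re = ∑ i, a i * c i := by
    have : (U * diagonal (fun i => (a i : ℂ)) * Uᴴ * Y).trace =
        (diagonal (fun i => (a i : ℂ)) * (Uᴴ * Y * U)).trace := by
      rw [mul_assoc, mul_assoc, trace_mul_comm]
      simp only [mul_assoc]
    rw [this, trace, Complex.re_sum]
    refine Finset.sum_congr rfl fun i _ => ?_
    rw [diag_apply, diagonal_mul, conj_apply_diag, Complex.re_ofReal_mul]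
  have hsum : ∑ i, c i ^ β ≤ (opPow Y β).trace.re := by
    calc ∑ i, c i ^ β ≤ ∑ i, (star (Uᵀ i) ⬝ᵥ opPow Y β *ᵥ (Uᵀ i)).re :=
          Finset.sum_le_sum fun i _ => dotProduct_mulVec_rpow_le hY h.symm.lt.le (hcol i)
      _ = (Uᴴ * opPow Y β * U).trace.re := by
          rw [trace, Complex.re_sum]
          exact Finset.sum_congr rfl fun i _ => by rw [diag_apply, conj_apply_diag]
      _ = _ := by rw [mul_assoc, trace_mul_comm, mul_assoc, mul_eq_one_comm.mp hU, mul_one]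
  rw [htr, re_trace_opPow hU]
  refine (Real.inner_le_Lp_mul_Lq_of_nonneg _ h (fun i _ => ha i) fun i _ => hc0 i).trans ?_
  have := h.symm.pos
  exact mul_le_mul_of_nonneg_left (Real.rpow_le_rpow
    (Finset.sum_nonneg fun i _ => Real.rpow_nonneg (hc0 i) _) hsum (by positivity))
    (Real.rpow_nonneg (Finset.sum_nonneg fun i _ => Real.rpow_nonneg (ha i) _) _)

/-- `Tᴴ * T` and `T * Tᴴ` have the same characteristic polynomial, hence the same eigenvalues. -/
theorem trace_opPow_conjTranspose_mul_self (T : Matrix κ κ ℂ) (p : ℝ) :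
    (opPow (Tᴴ * T) p).trace = (opPow (T * Tᴴ) p).trace := by
  have key : ∀ {A : Matrix κ κ ℂ} (hA : A.PosSemidef), (opPow A p).trace =
      (A.charpoly.roots.map fun z : ℂ => ((z.re ^ p : ℝ) : ℂ)).sum := by
    intro A hA
    rw [hA.1.roots_charpoly_eq_eigenvalues, Multiset.map_map]
    have : opPow A p = _ := hA.1.cfc_eq _
    rw [this, IsHermitian.cfc, Unitary.conjStarAlgAut_apply, trace_mul_comm, ← mul_assoc,
      Unitary.coe_star_mul_self, one_mul, trace_diagonal]
    rfl
  rw [key (posSemidef_conjTranspose_mul_self T), key (posSemidef_self_mul_conjTranspose T),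
    charpoly_mul_comm]

/-- The case of the Araki–Lieb–Thirring inequality in which one of the operators is a test, where
`M ^ β ≤ M`. -/
theorem re_trace_opPow_conj_test_le {σ M : Matrix κ κ ℂ} (hσ : σ.PosSemidef) (hM : IsTest M)
    {β : ℝ} (hβ : 1 ≤ β) :
    (opPow (opPow σ (1 / (2 * β)) * M * opPow σ (1 / (2 * β))) β).trace.re ≤
      (σ * M).trace.re := by
  have hβ0 : 0 < β := by linarith
  set K := opPow M (1 / 2) with hK
  have hKK : K * K = M := by
    rw [hK, opPow_mul_opPow hM.1 (by norm_num), add_halves, opPow_one hM.1]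
  have hKh : Kᴴ = K := (opPow_posSemidef hM.1 _).1
  set S := opPow σ (1 / (2 * β)) with hS
  have hSh : Sᴴ = S := (opPow_posSemidef hσ _).1
  have hSS : S * S = opPow σ (1 / β) := by
    rw [hS, opPow_mul_opPow hσ (by positivity)]
    congr 1
    field_simp
    norm_num
  have hY : S * M * S = (K * S)ᴴ * (K * S) := by
    rw [conjTranspose_mul, hKh, hSh, ← hKK]
    simp only [mul_assoc]
  have hZ : (K * S) * (K * S)ᴴ = K * opPow σ (1 / β) * K := by
    rw [conjTranspose_mul, hKh, hSh, ← hSS]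
    simp only [mul_assoc]
  -- The eigenvectors of `K * σ ^ (1 / β) * K` are the columns of `V`, with eigenvalues `z`.
  rw [hY, trace_opPow_conjTranspose_mul_self]
  obtain ⟨V, z, hV, hz, hVz⟩ :=
    exists_unitary_conj_diagonal (posSemidef_self_mul_conjTranspose (K * S))
  have hV' := mul_eq_one_comm.mp hV
  rw [hVz, re_trace_opPow hV]
  have hz_eq : ∀ i, z i = (star ((K * V)ᵀ i) ⬝ᵥ opPow σ (1 / β) *ᵥ ((K * V)ᵀ i)).re := fun i => by
    have h1 : (K * V)ᴴ * opPow σ (1 / β) * (K * V) = diagonal fun i => (z i : ℂ) := by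
      rw [conjTranspose_mul, hKh]
      calc _ = Vᴴ * (K * opPow σ (1 / β) * K) * V := by simp only [mul_assoc]
        _ = (Vᴴ * V) * diagonal (fun i => (z i : ℂ)) * (Vᴴ * V) := by
          rw [← hZ, hVz]
          simp only [mul_assoc]
        _ = _ := by rw [hV, one_mul, mul_one]
    rw [← conj_apply_diag, h1, diagonal_apply_eq, Complex.ofReal_re]
  have hnorm : ∀ i, (star ((K * V)ᵀ i) ⬝ᵥ (K * V)ᵀ i).re ≤ 1 := fun i => by
    have h1 := conj_apply_diag (K * V) 1 i
    rw [one_mulVec, mul_one, conjTranspose_mul, hKh, mul_assoc, ← mul_assoc K, hKK,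
      ← mul_assoc] at h1
    have h2 := (hM.2.conjTranspose_mul_mul_same V).diag_nonneg (i := i)
    rw [mul_sub, sub_mul, mul_one, hV, Matrix.sub_apply, one_apply_eq, h1] at h2
    have h3 := (Complex.le_def.1 h2).1
    rw [Complex.sub_re, Complex.one_re, Complex.zero_re] at h3
    linarith
  calc ∑ i, z i ^ β
      ≤ ∑ i, (star ((K * V)ᵀ i) ⬝ᵥ σ *ᵥ ((K * V)ᵀ i)).re := by
        refine Finset.sum_le_sum fun i _ => ?_
        rw [hz_eq i]
        refine (dotProduct_mulVec_rpow_le (opPow_posSemidef hσ _) hβ (hnorm i)).trans_eq ?_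
        rw [opPow_opPow hσ, one_div_mul_cancel hβ0.ne', opPow_one hσ]
    _ = ((K * V)ᴴ * σ * (K * V)).trace.re := by
        rw [trace, Complex.re_sum]
        exact Finset.sum_congr rfl fun i _ => by rw [diag_apply, conj_apply_diag]
    _ = (σ * M).trace.re := by
        congr 1
        rw [mul_assoc, trace_mul_comm, mul_assoc, conjTranspose_mul, hKh, mul_assoc K V,
          ← mul_assoc V, hV', one_mul, hKK]

/-! ### Data processing for tests -/

/-- The quantity whose logarithm is `(α - 1) D_α(ρ‖σ)`. -/
noncomputable def sandwichedQ (α : ℝ) (ρ σ : Matrix κ κ ℂ) : ℝ :=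
  (opPow (opPow σ ((1 - α) / (2 * α)) * ρ * opPow σ ((1 - α) / (2 * α))) α).trace.re

theorem posSemidef_opPow_conj {ρ σ : Matrix κ κ ℂ} (hρ : ρ.PosSemidef) (hσ : σ.PosSemidef)
    (p : ℝ) : (opPow σ p * ρ * opPow σ p).PosSemidef := by
  have := hρ.mul_mul_conjTranspose_same (opPow σ p)
  rwa [(opPow_posSemidef hσ p).1.eq] at this

theorem re_trace_mul_nonneg {X Y : Matrix κ κ ℂ} (hX : X.PosSemidef) (hY : Y.PosSemidef) :
    0 ≤ (X * Y).trace.re := by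
  have h : X * Y = X * opPow Y (1 / 2) * opPow Y (1 / 2) := by
    rw [mul_assoc, opPow_mul_opPow hY (by norm_num), add_halves, opPow_one hY]
  rw [h, trace_mul_comm, ← mul_assoc]
  exact (Complex.le_def.1 (posSemidef_opPow_conj hX hY _).trace_nonneg).1

/-- Data processing for the sandwiched divergence under the two-outcome measurement of a test,
with the contribution of the second outcome dropped. -/
theorem re_trace_mul_test_le {ρ σ M : Matrix κ κ ℂ} (hρ : ρ.PosSemidef) (hσ : σ.PosSemidef)
    (hM : IsTest M) (h : SuppLE ρ σ) {α : ℝ} (hα : 1 < α) :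
    (ρ * M).trace.re ≤
      sandwichedQ α ρ σ ^ (1 / α) * (σ * M).trace.re ^ ((α - 1) / α) := by
  have hα0 : 0 < α := by linarith
  have hα1 : 0 < α - 1 := by linarith
  have hconj : α.HolderConjugate (α / (α - 1)) := Real.HolderConjugate.conjExponent hα
  set β := α / (α - 1) with hβ
  set p := (1 - α) / (2 * α) with hp
  have hpβ : -p = 1 / (2 * β) := by
    rw [hp, hβ]
    field_simp
    ring
  have hX := posSemidef_opPow_conj hρ hσ p
  have hY := posSemidef_opPow_conj hM.1 hσ (-p)
  have htr : (ρ * M).trace =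
      ((opPow σ p * ρ * opPow σ p) * (opPow σ (-p) * M * opPow σ (-p))).trace := by
    conv_lhs => rw [← h.eq_conj hρ hσ (-p), neg_neg, mul_assoc, mul_assoc, trace_mul_comm]
    simp only [mul_assoc]
  rw [htr]
  refine (re_trace_mul_le_holder hX hY hconj).trans ?_
  have hexp : (α - 1) / α = 1 / β := by rw [hβ, one_div_div]
  rw [hexp]
  refine mul_le_mul_of_nonneg_left (Real.rpow_le_rpow (re_trace_opPow_nonneg hY _) ?_ ?_)
    (Real.rpow_nonneg (re_trace_opPow_nonneg hX _) _)
  · rw [hpβ]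
    exact re_trace_opPow_conj_test_le hσ hM hconj.symm.lt.le
  · exact one_div_nonneg.2 hconj.symm.pos.le

/-- Nonnegativity of `D_α` on states, from the trivial test `1`. In particular the logarithm of
`sandwichedQ` is never taken at `0`. -/
theorem one_le_sandwichedQ {ρ σ : Matrix κ κ ℂ} (hρ : ρ ∈ density κ) (hσ : σ ∈ density κ)
    (h : SuppLE ρ σ) {α : ℝ} (hα : 1 < α) : 1 ≤ sandwichedQ α ρ σ := by
  have hM : IsTest (1 : Matrix κ κ ℂ) := ⟨PosSemidef.one, by rw [sub_self]; exact PosSemidef.zero⟩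
  have h1 := re_trace_mul_test_le hρ.1 hσ.1 hM h hα
  rw [mul_one, mul_one, hρ.2, hσ.2, Complex.one_re, Real.one_rpow, mul_one] at h1
  by_contra! hlt
  exact absurd h1 (not_le.2 (Real.rpow_lt_one
    (re_trace_opPow_nonneg (posSemidef_opPow_conj hρ.1 hσ.1 _) _) hlt (by positivity)))

theorem sandwichedDiv_of_suppLE {ρ σ : Matrix κ κ ℂ} (h : SuppLE ρ σ) (α : ℝ) :
    sandwichedDiv α ρ σ = ((1 / (α - 1) * Real.logb 2 (sandwichedQ α ρ σ) : ℝ) : EReal) :=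
  if_pos h

theorem coe_mul_sub_sandwichedDiv_of_not_suppLE {ρ σ : Matrix κ κ ℂ} (h : ¬ SuppLE ρ σ) {α : ℝ}
    (hα : 1 < α) (s : ℝ) :
    (((α - 1) / α : ℝ) : EReal) * ((s : EReal) - sandwichedDiv α ρ σ) = ⊥ := by
  have : 0 < (α - 1) / α := div_pos (by linarith) (by linarith)
  rw [sandwichedDiv, if_neg h, EReal.sub_top, EReal.coe_mul_bot_of_pos this]

theorem re_trace_mul_test_le_one {ρ M : Matrix κ κ ℂ} (hρ : ρ ∈ density κ) (hM : IsTest M) :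
    (ρ * M).trace.re ≤ 1 := by
  have := re_trace_mul_nonneg hρ.1 hM.2
  rw [mul_sub, mul_one, trace_sub, Complex.sub_re, hρ.2, Complex.one_re] at this
  linarith

theorem IsTest.one_sub {l : Type*} [DecidableEq l] {M : Matrix l l ℂ} (hM : IsTest M) :
    IsTest (1 - M) :=
  ⟨hM.2, by rw [sub_sub_cancel]; exact hM.1⟩

/-! ### The one-shot strong converse -/

/-- One minus the optimal type-I error is at most any bound, valid for all admissible tests, on the
success probability in one state of `A`. -/
theorem one_sub_optTypeI_le {A B : Set (Matrix κ κ ℂ)} (hA : A ⊆ density κ) (hB : B ⊆ density κ)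
    {ε e : ℝ} (hε : 0 ≤ ε) {ρ σ : Matrix κ κ ℂ} (hρ : ρ ∈ A) (hσ : σ ∈ B)
    (h : ∀ M, IsTest M → (σ * M).trace.re ≤ ε → (ρ * M).trace.re ≤ e) :
    1 - optTypeI ε A B ≤ e := by
  have hbd : ∀ {C : Set (Matrix κ κ ℂ)}, C ⊆ density κ → ∀ {M}, IsTest M →
      BddAbove ((fun ρ => (ρ * M).trace.re) '' C) := by
    rintro C hC M hM
    exact ⟨1, by rintro _ ⟨x, hx, rfl⟩; exact re_trace_mul_test_le_one (hC hx) hM⟩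
  -- The zero test is admissible, so that the infimum is not the junk value of an empty set.
  have hzero : (typeI A '' {M | IsTest M ∧ typeII B M ≤ ε}).Nonempty := by
    refine Set.Nonempty.image _ ⟨0, ⟨PosSemidef.zero, by rw [sub_zero]; exact PosSemidef.one⟩, ?_⟩
    refine csSup_le ((Set.nonempty_of_mem hσ).image _) ?_
    rintro _ ⟨τ, -, rfl⟩
    simpa using hε
  have : 1 - e ≤ optTypeI ε A B := by
    refine le_csInf hzero ?_
    rintro _ ⟨M, ⟨hM, hMε⟩, rfl⟩
    have h1 : (σ * M).trace.re ≤ typeII B M := le_csSup (hbd hB hM) ⟨σ, hσ, rfl⟩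
    have h2 : (ρ * (1 - M)).trace.re ≤ typeI A M := le_csSup (hbd hA hM.one_sub) ⟨ρ, hρ, rfl⟩
    have h3 := h M hM (h1.trans hMε)
    rw [mul_sub, mul_one, trace_sub, Complex.sub_re, (hA hρ).2, Complex.one_re] at h2
    linarith
  linarith

/-- The one-shot strong converse bound: the success probability of any test with worst-case type-II
error at most `2 ^ (-s)` is exponentially small in the Hoeffding anti-divergence. -/
theorem antiDivSet_le_neg_elog2 {A B : Set (Matrix κ κ ℂ)} (hA : A ⊆ density κ)
    (hB : B ⊆ density κ) (s : ℝ) :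
    antiDivSet s A B ≤ -elog2 (1 - optTypeI ((2 : ℝ) ^ (-s)) A B) := by
  refine iSup₂_le fun ρ hρ => iSup₂_le fun σ hσ => iSup₂_le fun α hα => ?_
  by_cases hsupp : SuppLE ρ σ
  swap
  · rw [coe_mul_sub_sandwichedDiv_of_not_suppLE hsupp hα]
    exact bot_le
  have hα0 : 0 < α := by linarith
  have hα1 : 0 < α - 1 := by linarith
  have hQ : 0 < sandwichedQ α ρ σ :=
    one_pos.trans_le (one_le_sandwichedQ (hA hρ) (hB hσ) hsupp hα)
  set e : ℝ := sandwichedQ α ρ σ ^ (1 / α) * ((2 : ℝ) ^ (-s)) ^ ((α - 1) / α) with he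
  have h2s : (0 : ℝ) < (2 : ℝ) ^ (-s) := Real.rpow_pos_of_pos two_pos _
  have hopt : 1 - optTypeI ((2 : ℝ) ^ (-s)) A B ≤ e := by
    refine one_sub_optTypeI_le hA hB h2s.le hρ hσ fun M hM hMs => ?_
    refine (re_trace_mul_test_le (hA hρ).1 (hB hσ).1 hM hsupp hα).trans ?_
    exact mul_le_mul_of_nonneg_left (Real.rpow_le_rpow (re_trace_mul_nonneg (hB hσ).1 hM.1) hMs
      (div_nonneg hα1.le hα0.le)) (Real.rpow_nonneg hQ.le _)
  rw [elog2]
  split_ifs with hle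
  · simp
  have hlog : Real.logb 2 e = 1 / α * Real.logb 2 (sandwichedQ α ρ σ) - (α - 1) / α * s := by
    rw [he, Real.logb_mul (Real.rpow_pos_of_pos hQ _).ne' (Real.rpow_pos_of_pos h2s _).ne',
      Real.logb_rpow_eq_mul_logb_of_pos hQ, Real.logb_rpow_eq_mul_logb_of_pos h2s,
      Real.logb_rpow two_pos (by norm_num)]
    ring
  rw [sandwichedDiv_of_suppLE hsupp, ← EReal.coe_sub, ← EReal.coe_mul, ← EReal.coe_neg,
    EReal.coe_le_coe_iff, le_neg]
  refine (Real.logb_le_logb_of_le one_lt_two (not_le.1 hle) hopt).trans_eq ?_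
  rw [hlog]
  field_simp
  ring

end Single

section Sequences

variable {ι : Type*} {m n : ℕ}

/-! ### Tensor products -/

theorem tensor_conjTranspose (X : Op ι m) (Y : Op ι n) : (tensor X Y)ᴴ = tensor Xᴴ Yᴴ := by
  simp only [tensor, reindex_apply, conjTranspose_submatrix, conjTranspose_kronecker]

theorem tensor_one_one [DecidableEq ι] : tensor (1 : Op ι m) (1 : Op ι n) = 1 := by
  simp only [tensor, reindex_apply, one_kronecker_one, submatrix_one_equiv]

theorem tensor_diagonal [DecidableEq ι] (a : (Fin m → ι) → ℝ) (b : (Fin n → ι) → ℝ) :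
    tensor (diagonal fun i => (a i : ℂ)) (diagonal fun i => (b i : ℂ)) =
      diagonal fun k => ((a ((Fin.appendEquiv m n).symm k).1 *
        b ((Fin.appendEquiv m n).symm k).2 : ℝ) : ℂ) := by
  rw [tensor, reindex_apply, diagonal_kronecker_diagonal, submatrix_diagonal_equiv]
  congr 1
  ext k
  simp

variable [Fintype ι]

theorem tensor_mul_tensor (X X' : Op ι m) (Y Y' : Op ι n) :
    tensor X Y * tensor X' Y' = tensor (X * X') (Y * Y') := by
  simp only [tensor, reindex_apply, submatrix_mul_equiv, mul_kronecker_mul]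

theorem trace_tensor (X : Op ι m) (Y : Op ι n) : (tensor X Y).trace = X.trace * Y.trace := by
  rw [tensor, reindex_apply, ← trace_kronecker]
  exact Equiv.sum_comp (Fin.appendEquiv m n).symm fun k => (X ⊗ₖ Y) k k

variable [DecidableEq ι]

theorem opPow_tensor {X : Op ι m} {Y : Op ι n} (hX : X.PosSemidef) (hY : Y.PosSemidef) (p : ℝ) :
    opPow (tensor X Y) p = tensor (opPow X p) (opPow Y p) := by
  obtain ⟨U, a, hU, ha, rfl⟩ := exists_unitary_conj_diagonal hX
  obtain ⟨V, b, hV, hb, rfl⟩ := exists_unitary_conj_diagonal hY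
  have hUV : (tensor U V)ᴴ * tensor U V = 1 := by
    rw [tensor_conjTranspose, tensor_mul_tensor, hU, hV, tensor_one_one]
  rw [opPow_unitary_conj_diagonal hU, opPow_unitary_conj_diagonal hV]
  simp only [← tensor_mul_tensor, ← tensor_conjTranspose, tensor_diagonal]
  rw [opPow_unitary_conj_diagonal hUV]
  simp only [Real.mul_rpow (ha _) (hb _)]

theorem SuppLE.tensor {ρ σ : Op ι m} {ρ' σ' : Op ι n} (h : SuppLE ρ σ) (h' : SuppLE ρ' σ') :
    SuppLE (tensor ρ ρ') (tensor σ σ') := by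
  obtain ⟨Z, hZ⟩ := suppLE_iff_exists_eq_mul.1 h
  obtain ⟨Z', hZ'⟩ := suppLE_iff_exists_eq_mul.1 h'
  exact suppLE_iff_exists_eq_mul.2 ⟨QHT.tensor Z Z', by rw [tensor_mul_tensor, ← hZ, ← hZ']⟩

theorem sandwichedQ_tensor {ρ σ : Op ι m} {ρ' σ' : Op ι n} (hρ : ρ.PosSemidef)
    (hσ : σ.PosSemidef) (hρ' : ρ'.PosSemidef) (hσ' : σ'.PosSemidef) (α : ℝ) :
    sandwichedQ α (tensor ρ ρ') (tensor σ σ') = sandwichedQ α ρ σ * sandwichedQ α ρ' σ' := by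
  have hX := posSemidef_opPow_conj hρ hσ ((1 - α) / (2 * α))
  have hY := posSemidef_opPow_conj hρ' hσ' ((1 - α) / (2 * α))
  have him := (Complex.le_def.1 (opPow_posSemidef hX α).trace_nonneg).2
  rw [sandwichedQ, opPow_tensor hσ hσ', tensor_mul_tensor, tensor_mul_tensor, opPow_tensor hX hY,
    trace_tensor, Complex.mul_re, ← him, Complex.zero_im, zero_mul, sub_zero]
  rfl

variable {A B : (n : ℕ) → Set (Op ι n)}

/-- Tensoring a pair of states `q` times with another pair stays in the sets and, at a fixed order
`α`, adds up the sandwiched divergences. -/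
theorem exists_tensor_pow (hA_sub : ∀ n, 1 ≤ n → A n ⊆ density (Fin n → ι))
    (hB_sub : ∀ n, 1 ≤ n → B n ⊆ density (Fin n → ι)) (hA : IsStable A) (hB : IsStable B)
    {s : ℕ} (hm : 1 ≤ m) (hs : 1 ≤ s) {α : ℝ} (hα : 1 < α)
    {ρ σ : Op ι m} (hρ : ρ ∈ A m) (hσ : σ ∈ B m) (h : SuppLE ρ σ)
    {ρ₀ σ₀ : Op ι s} (hρ₀ : ρ₀ ∈ A s) (hσ₀ : σ₀ ∈ B s) (h₀ : SuppLE ρ₀ σ₀) (q : ℕ) :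
    ∃ ρ' ∈ A (s + q * m), ∃ σ' ∈ B (s + q * m), SuppLE ρ' σ' ∧
      Real.logb 2 (sandwichedQ α ρ' σ') =
        Real.logb 2 (sandwichedQ α ρ₀ σ₀) + q * Real.logb 2 (sandwichedQ α ρ σ) := by
  induction q with
  | zero =>
    rw [zero_mul, add_zero]
    exact ⟨ρ₀, hρ₀, σ₀, hσ₀, h₀, by simp⟩
  | succ q ih =>
    obtain ⟨ρ', hρ', σ', hσ', h', hl⟩ := ih
    have hk : 1 ≤ s + q * m := by omega
    rw [show s + (q + 1) * m = s + q * m + m by ring]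
    refine ⟨_, hA _ _ hk hm _ hρ' _ hρ, _, hB _ _ hk hm _ hσ' _ hσ, h'.tensor h, ?_⟩
    have h1 := one_le_sandwichedQ (hA_sub _ hk hρ') (hB_sub _ hk hσ') h' hα
    have h2 := one_le_sandwichedQ (hA_sub _ hm hρ) (hB_sub _ hm hσ) h hα
    rw [sandwichedQ_tensor (hA_sub _ hk hρ').1 (hB_sub _ hk hσ').1 (hA_sub _ hm hρ).1
      (hB_sub _ hm hσ).1, Real.logb_mul (by positivity) (by positivity), hl]
    push_cast
    ring

/-! ### Convergence of the normalized anti-divergences -/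

theorem le_antiDivRate {r : ℝ} {ρ σ : Op ι n} (hρ : ρ ∈ A n) (hσ : σ ∈ B n) (h : SuppLE ρ σ)
    {α : ℝ} (hα : 1 < α) :
    ((1 / (n : ℝ) * ((α - 1) / α * (n * r - 1 / (α - 1) * Real.logb 2 (sandwichedQ α ρ σ))) : ℝ) :
      EReal) ≤ antiDivRate r A B n := by
  rw [antiDivRate, EReal.coe_mul]
  refine mul_le_mul_of_nonneg_left ?_ (EReal.coe_nonneg.2 (by positivity))
  refine le_trans ?_ (le_iSup₂_of_le ρ hρ (le_iSup₂_of_le σ hσ (le_iSup₂_of_le α hα le_rfl)))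
  rw [sandwichedDiv_of_suppLE h, ← EReal.coe_sub, ← EReal.coe_mul]

/-- The supremum over all blocklengths, pairs of states and orders of the normalized expression
defining the Hoeffding anti-divergence. -/
noncomputable def supAntiDivRate (r : ℝ) (A B : (n : ℕ) → Set (Op ι n)) : EReal :=
  ⨆ (n : ℕ) (_ : 1 ≤ n) (ρ ∈ A n) (σ ∈ B n) (α : ℝ) (_ : 1 < α),
    ((1 / (n : ℝ) : ℝ) : EReal) *
      ((((α - 1) / α : ℝ) : EReal) * (((n * r : ℝ) : EReal) - sandwichedDiv α ρ σ))

theorem antiDivRate_le_supAntiDivRate (r : ℝ) (A B : (n : ℕ) → Set (Op ι n)) (hn : 1 ≤ n) :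
    antiDivRate r A B n ≤ supAntiDivRate r A B := by
  have hn' : (0 : ℝ) < n := by exact_mod_cast hn
  have h1 : antiDivSet ((n : ℝ) * r) (A n) (B n) ≤ ((n : ℝ) : EReal) * supAntiDivRate r A B := by
    refine iSup₂_le fun ρ hρ => iSup₂_le fun σ hσ => iSup₂_le fun α hα => ?_
    have h2 : ((1 / (n : ℝ) : ℝ) : EReal) * ((((α - 1) / α : ℝ) : EReal) *
        (((n * r : ℝ) : EReal) - sandwichedDiv α ρ σ)) ≤ supAntiDivRate r A B :=
      le_iSup₂_of_le n hn (le_iSup₂_of_le ρ hρ (le_iSup₂_of_le σ hσ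
        (le_iSup₂_of_le α hα le_rfl)))
    refine le_trans (le_of_eq ?_) (mul_le_mul_of_nonneg_left h2 (EReal.coe_nonneg.2 hn'.le))
    rw [← mul_assoc, ← EReal.coe_mul, mul_one_div_cancel hn'.ne', EReal.coe_one, one_mul]
  refine (mul_le_mul_of_nonneg_left h1 (EReal.coe_nonneg.2 (by positivity))).trans_eq ?_
  rw [← mul_assoc, ← EReal.coe_mul, one_div_mul_cancel hn'.ne', EReal.coe_one, one_mul]

/-- Fekete's argument at a fixed order `α`: a large blocklength is split into many blocks of length
`m` and one remaining block, whose length is at least `N` and less than `N + m`. -/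
theorem isRegAntiDiv_supAntiDivRate (r : ℝ)
    (hA_sub : ∀ n, 1 ≤ n → A n ⊆ density (Fin n → ι))
    (hB_sub : ∀ n, 1 ≤ n → B n ⊆ density (Fin n → ι)) (hA : IsStable A) (hB : IsStable B)
    (h : ∀ᶠ n : ℕ in atTop, ∃ ρ ∈ A n, ∃ σ ∈ B n, SuppLE ρ σ) :
    IsRegAntiDiv r A B (supAntiDivRate r A B) := by
  refine tendsto_order.2 ⟨fun c hc => ?_, fun c hc => ?_⟩
  swap
  · filter_upwards [eventually_ge_atTop 1] with n hn
    exact (antiDivRate_le_supAntiDivRate r A B hn).trans_lt hc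
  obtain ⟨m, hc⟩ := lt_iSup_iff.1 hc
  obtain ⟨hm, hc⟩ := lt_iSup_iff.1 hc
  obtain ⟨ρ, hc⟩ := lt_iSup_iff.1 hc
  obtain ⟨hρ, hc⟩ := lt_iSup_iff.1 hc
  obtain ⟨σ, hc⟩ := lt_iSup_iff.1 hc
  obtain ⟨hσ, hc⟩ := lt_iSup_iff.1 hc
  obtain ⟨α, hc⟩ := lt_iSup_iff.1 hc
  obtain ⟨hα, hc⟩ := lt_iSup_iff.1 hc
  have hm' : (0 : ℝ) < m := by exact_mod_cast hm
  have hα0 : 0 < α := by linarith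
  have hα1 : 0 < α - 1 := by linarith
  have hsupp : SuppLE ρ σ := by
    by_contra hns
    rw [coe_mul_sub_sandwichedDiv_of_not_suppLE hns hα, EReal.coe_mul_bot_of_pos (by positivity)]
      at hc
    exact not_lt_bot hc
  rw [sandwichedDiv_of_suppLE hsupp, ← EReal.coe_sub, ← EReal.coe_mul, ← EReal.coe_mul] at hc
  set l := Real.logb 2 (sandwichedQ α ρ σ) with hl
  obtain ⟨N, hN⟩ := eventually_atTop.1 (h.and (eventually_ge_atTop 1))
  have hN1 : 1 ≤ N := (hN N le_rfl).2
  -- A common bound for the contribution of the remaining block.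
  obtain ⟨C, hC⟩ : ∃ C : ℝ, ∀ s, N ≤ s → s < N + m → ∃ ρ₀ ∈ A s, ∃ σ₀ ∈ B s, SuppLE ρ₀ σ₀ ∧
      Real.logb 2 (sandwichedQ α ρ₀ σ₀) - s * (l / m) ≤ C := by
    have hex : ∀ s, ∃ C : ℝ, N ≤ s → ∃ ρ₀ ∈ A s, ∃ σ₀ ∈ B s, SuppLE ρ₀ σ₀ ∧
        Real.logb 2 (sandwichedQ α ρ₀ σ₀) - s * (l / m) ≤ C := by
      intro s
      by_cases hs : N ≤ s
      · obtain ⟨ρ₀, hρ₀, σ₀, hσ₀, h₀⟩ := (hN s hs).1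
        exact ⟨_, fun _ => ⟨ρ₀, hρ₀, σ₀, hσ₀, h₀, le_rfl⟩⟩
      · exact ⟨0, fun hs' => absurd hs' hs⟩
    choose f hf using hex
    obtain ⟨C, hC⟩ := ((Finset.range (N + m)).image f).exists_le
    refine ⟨C, fun s hs hs' => ?_⟩
    obtain ⟨ρ₀, hρ₀, σ₀, hσ₀, h₀, hle⟩ := hf s hs
    exact ⟨ρ₀, hρ₀, σ₀, hσ₀, h₀,
      hle.trans (hC _ (Finset.mem_image_of_mem f (Finset.mem_range.2 hs')))⟩
  -- Lower bound for the rate at blocklength `n`; it tends to the value of the chosen triple.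
  let g : ℕ → ℝ := fun n => (α - 1) / α * (r - 1 / (α - 1) * (l / m + C / n))
  have hg : Tendsto g atTop (𝓝 (1 / (m : ℝ) * ((α - 1) / α * (m * r - 1 / (α - 1) * l)))) := by
    have h1 : Tendsto (fun n : ℕ => C / (n : ℝ)) atTop (𝓝 0) :=
      tendsto_const_div_atTop_nhds_zero_nat C
    have h2 := (((h1.const_add (l / m)).const_mul (1 / (α - 1))).const_sub r).const_mul
      ((α - 1) / α)
    convert h2 using 2
    field_simp
    ring
  have hg' := (continuous_coe_real_ereal.tendsto _).comp hg
  filter_upwards [hg'.eventually (lt_mem_nhds hc), eventually_ge_atTop N] with n hcn hn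
  refine hcn.trans_le ?_
  have hs : N + (n - N) % m < N + m := Nat.add_lt_add_left (Nat.mod_lt _ hm) N
  obtain ⟨ρ₀, hρ₀, σ₀, hσ₀, h₀, hle⟩ := hC _ (Nat.le_add_right N ((n - N) % m)) hs
  obtain ⟨ρ', hρ', σ', hσ', h', hl'⟩ := exists_tensor_pow hA_sub hB_sub hA hB hm
    (hN1.trans (Nat.le_add_right N ((n - N) % m))) hα hρ hσ hsupp hρ₀ hσ₀ h₀ ((n - N) / m)
  have hnsq : N + (n - N) % m + (n - N) / m * m = n := by
    rw [add_assoc, mul_comm, Nat.mod_add_div]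
    omega
  have hn0 : (0 : ℝ) < n := by exact_mod_cast hN1.trans hn
  have hcast : ((N + (n - N) % m : ℕ) : ℝ) + ((n - N) / m : ℕ) * m = n := by
    exact_mod_cast hnsq
  generalize N + (n - N) % m = s at *
  generalize (n - N) / m = q at *
  subst hnsq
  refine le_trans (EReal.coe_le_coe_iff.2 ?_) (le_antiDivRate hρ' hσ' h' hα)
  rw [hl', ← hl]
  set x := Real.logb 2 (sandwichedQ α ρ₀ σ₀)
  set k : ℝ := ((s + q * m : ℕ) : ℝ)
  have hx : x + q * l ≤ k * (l / m) + C := by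
    have : k * (l / m) = s * (l / m) + q * l := by
      rw [← hcast]
      field_simp
    linarith
  have hrhs : 1 / k * ((α - 1) / α * (k * r - 1 / (α - 1) * (x + q * l))) =
      (α - 1) / α * (r - 1 / (α - 1) * ((x + q * l) / k)) := by
    field_simp
  have hdiv : (x + q * l) / k ≤ l / m + C / k := by
    rw [div_le_iff₀ hn0, add_mul, div_mul_cancel₀ _ hn0.ne']
    linarith
  rw [hrhs]
  refine mul_le_mul_of_nonneg_left (sub_le_sub_left ?_ r) (by positivity)
  exact mul_le_mul_of_nonneg_left hdiv (by positivity)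

end Sequences

end QHT

theorem mainTheorem2 {ι : Type*} [Fintype ι] [DecidableEq ι] (r : ℝ) (hr : 0 < r)
    (A B : (n : ℕ) → Set (QHT.Op ι n))
    (hA_sub : ∀ n, 1 ≤ n → A n ⊆ QHT.density (Fin n → ι))
    (hB_sub : ∀ n, 1 ≤ n → B n ⊆ QHT.density (Fin n → ι))
    (hA_nonempty : ∀ n, 1 ≤ n → (A n).Nonempty)
    (hB_nonempty : ∀ n, 1 ≤ n → (B n).Nonempty)
    (hA_convex : ∀ n, 1 ≤ n → Convex ℝ (A n))
    (hB_convex : ∀ n, 1 ≤ n → Convex ℝ (B n))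
    (hA_compact : ∀ n, 1 ≤ n → IsCompact (A n))
    (hB_compact : ∀ n, 1 ≤ n → IsCompact (B n))
    (hA_stable : QHT.IsStable A) (hB_stable : QHT.IsStable B) :
    QHT.lowerRegAntiDiv r A B ≤ QHT.strongConverseExponent r A B ∧
    ((∀ᶠ n : ℕ in atTop, ∃ ρ ∈ A n, ∃ σ ∈ B n, QHT.SuppLE ρ σ) →
      ∃ L : EReal, QHT.IsRegAntiDiv r A B L ∧ L ≤ QHT.strongConverseExponent r A B) := by
  have h1 : QHT.lowerRegAntiDiv r A B ≤ QHT.strongConverseExponent r A B := by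
    refine liminf_le_liminf ?_
    filter_upwards [eventually_ge_atTop 1] with n hn
    rw [← mul_neg]
    exact mul_le_mul_of_nonneg_left
      (QHT.antiDivSet_le_neg_elog2 (hA_sub n hn) (hB_sub n hn) ((n : ℝ) * r))
      (EReal.coe_nonneg.2 (by positivity))
  refine ⟨h1, fun h => ?_⟩
  have hL := QHT.isRegAntiDiv_supAntiDivRate r hA_sub hB_sub hA_stable hB_stable h
  exact ⟨_, hL, hL.liminf_eq.symm.trans_le h1⟩
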